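/- Let $f$ be a Rademacher random multiplicative function: the values $f(p)$ at the primes $p$ are independent random variables, each equal to $+1$ or $-1$ with probability $1/2$, and $f(n)=\mu^2(n)\prod_{p\mid n}f(p)$ for every positive integer $n$, where $\mu$ is the Möbius function. Let $\delta>0$ and $\theta\in(0,1)$. Then there exists $\sigma_0\in(1/2,1]$, depending only on $\delta$ and $\theta$, such that for all $1/2<\sigma\le\sigma_0$, with $x\ge 1$ defined by $$\log x=\frac{1}{(\sigma-1/2)^{1/\theta}},$$ the probability that the partial sum $\sum_{n\le y}\frac{f(n)}{n^\sigma}$ is negative for some real $y>x$ is at most $$\exp\left(-\frac{1}{2\theta}\frac{(\log x)^{2-2\theta}}{(\log\log x)^{1+2\delta}}\right).$$ -/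

import Mathlib

open MeasureTheory ProbabilityTheory

/-- `f` is a Rademacher random multiplicative function on the probability space `(Ω, P)`:
the values at primes are independent random variables, each equal to `1` or `-1` with
probability `1/2`, and `f n = μ(n)² ∏_{p ∣ n} f p` for every positive integer `n`. -/
structure IsRademacherMultiplicative {Ω : Type*} [MeasurableSpace Ω] (P : Measure Ω)
    (f : ℕ → Ω → ℝ) : Prop where
  measurable_prime : ∀ p : ℕ, p.Prime → Measurable (f p)
  prob_one : ∀ p : ℕ, p.Prime → P {ω | f p ω = 1} = 1 / 2
  prob_neg_one : ∀ p : ℕ, p.Prime → P {ω | f p ω = -1} = 1 / 2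
  indep : iIndepFun (fun (p : Nat.Primes) => f (p : ℕ)) P
  apply_eq : ∀ n : ℕ, 1 ≤ n → ∀ ω : Ω,
    f n ω = (ArithmeticFunction.moebius n : ℝ) ^ 2 * ∏ p ∈ n.primeFactors, f p ω

/-- The weighted partial sum `∑_{1 ≤ n ≤ y} f(n) / n ^ σ`, for real `y`. -/
noncomputable def weightedPartialSum {Ω : Type*} (f : ℕ → Ω → ℝ) (σ y : ℝ) (ω : Ω) : ℝ :=
  ∑ n ∈ Finset.Icc 1 ⌊y⌋₊, f n ω / (n : ℝ) ^ σ

/-! ### Hypercontractivity for Rademacher chaoses -/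

/-! Put η = σ - 1/2. Summing f(n)/n^σ over all n composed of primes up to N gives the Euler product
∏ (1 + f(p) p^(-σ)), which is positive. For y with ⌊y⌋ ≤ N the partial sum is this product minus a
tail over n > y, so it can be negative only if the product is small or some tail is large.

Small product: its logarithm is at least ∑ f(p) p^(-σ) - 4 ∑ p^(-2σ). The first sum is sub-Gaussian
with variance V = O(log(1/η)) for small η, so the product is at most e^(-r) with probability at most
exp(-(r - 4V)²/(2V)) (`measureReal_euler_le`).

Large tail: the tail is a multilinear polynomial in independent signs. Bonami's inequality
(`integral_chaos_pow_le`) bounds its 2k-th moment by the k-th power of a weighted sum of squared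
coefficients. That sum is additive over blocks of n, so a bisection argument
(`exists_maximal_bound`) controls all tails at once for a factor 25^k, and Rankin's trick
(`sum_tail_le`) extracts a saving x^(-η).

With D = η log x and ℓ = log log x, the choices r = D/8 and k ≈ D/(4ℓ) make both probabilities at
most exp(-D²/(1024ℓ)), uniformly in N. The extra factor ℓ^(2δ) in the target absorbs all constants.
-/

lemma Finset.sum_range_two_mul_add_one {M : Type*} [AddCommMonoid M] (h : ℕ → M) (k : ℕ) :
    ∑ m ∈ Finset.range (2 * k + 1), h m =
      ∑ j ∈ Finset.range (k + 1), h (2 * j) + ∑ j ∈ Finset.range k, h (2 * j + 1) := by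
  induction k with
  | zero => simp
  | succ k ih =>
    rw [show 2 * (k + 1) + 1 = 2 * k + 1 + 1 + 1 by ring, Finset.sum_range_succ,
      Finset.sum_range_succ, ih, Finset.sum_range_succ _ (k + 1),
      Finset.sum_range_succ (fun j => h (2 * j + 1)) k, show 2 * (k + 1) = 2 * k + 1 + 1 by ring]
    abel

/-- Passing from j to j + 1, the ratio of the two sides' growth factors is (2(k - j) - 1) / ((2j +
1) K), which is at most 1. -/
lemma Nat.cast_choose_two_mul_le {k : ℕ} {K : ℝ} (hK0 : 0 ≤ K) (hK : 2 * (k : ℝ) - 1 ≤ K)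
    (j : ℕ) : ((2 * k).choose (2 * j) : ℝ) ≤ k.choose j * K ^ j := by
  induction j with
  | zero => simp
  | succ j ih =>
    rcases lt_or_ge j k with hjk | hjk
    swap
    · rw [Nat.choose_eq_zero_of_lt (by omega)]
      simp only [Nat.cast_zero]; positivity
    have h1 : ((2 * k).choose (2 * j + 1) : ℝ) * (2 * j + 1) =
        (2 * k).choose (2 * j) * (2 * (k - j)) := by
      have := Nat.choose_succ_right_eq (2 * k) (2 * j)
      have h := congrArg (Nat.cast (R := ℝ)) this
      rw [Nat.cast_mul, Nat.cast_mul, Nat.cast_sub (by omega)] at h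
      push_cast at h; rw [h]; ring
    have h2 : ((2 * k).choose (2 * (j + 1)) : ℝ) * (2 * j + 2) =
        (2 * k).choose (2 * j + 1) * (2 * (k - j) - 1) := by
      have := Nat.choose_succ_right_eq (2 * k) (2 * j + 1)
      have h := congrArg (Nat.cast (R := ℝ)) this
      rw [Nat.cast_mul, Nat.cast_mul, Nat.cast_sub (by omega)] at h
      push_cast at h
      rw [show 2 * (j + 1) = 2 * j + 1 + 1 by ring]
      linear_combination h
    have h3 : (k.choose (j + 1) : ℝ) * (j + 1) = k.choose j * (k - j) := by
      have h := congrArg (Nat.cast (R := ℝ)) (Nat.choose_succ_right_eq k j)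
      rw [Nat.cast_mul, Nat.cast_mul, Nat.cast_sub (by omega)] at h
      push_cast at h; exact h
    have hkj : (j : ℝ) + 1 ≤ k := by exact_mod_cast hjk
    have hj : (0 : ℝ) ≤ j := by positivity
    have hpos : (0 : ℝ) < (2 * j + 1) * (2 * j + 2) := by positivity
    refine le_of_mul_le_mul_right ?_ hpos
    calc ((2 * k).choose (2 * (j + 1)) : ℝ) * ((2 * j + 1) * (2 * j + 2))
        = (2 * k).choose (2 * j) * (2 * (k - j) * (2 * (k - j) - 1)) := by
          linear_combination (2 * (j : ℝ) + 1) * h2 + (2 * ((k : ℝ) - j) - 1) * h1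
      _ ≤ (k.choose j * K ^ j) * (2 * (k - j) * (2 * (k - j) - 1)) := by
          refine mul_le_mul_of_nonneg_right ih (mul_nonneg ?_ ?_) <;> linarith
      _ = (k.choose j * (k - j)) * 2 * K ^ j * (2 * (k - j) - 1) := by ring
      _ = k.choose (j + 1) * (2 * j + 2) * K ^ j * (2 * (k - j) - 1) := by rw [← h3]; ring
      _ ≤ k.choose (j + 1) * (2 * j + 2) * K ^ j * (K * (2 * j + 1)) := by
          refine mul_le_mul_of_nonneg_left ?_ (by positivity)
          nlinarith
      _ = _ := by ring

/-- Averaging over the sign of b kills the odd powers; the even binomial coefficients are then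
compared one by one. -/
lemma two_point_inequality {k : ℕ} {K : ℝ} (hK0 : 0 ≤ K) (hK : 2 * (k : ℝ) - 1 ≤ K) (a b : ℝ) :
    ((a + b) ^ (2 * k) + (a - b) ^ (2 * k)) / 2 ≤ (a ^ 2 + K * b ^ 2) ^ k := by
  have h1 : ((a + b) ^ (2 * k) + (a - b) ^ (2 * k)) / 2 =
      ∑ j ∈ Finset.range (k + 1), b ^ (2 * j) * a ^ (2 * k - 2 * j) * (2 * k).choose (2 * j) := by
    rw [add_comm a b, show a - b = -b + a by ring, add_pow, add_pow, ← Finset.sum_add_distrib,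
      Finset.sum_range_two_mul_add_one, Finset.sum_eq_zero (s := Finset.range k), add_zero,
      Finset.sum_div]
    · refine Finset.sum_congr rfl fun j _ => ?_
      rw [Even.neg_pow (even_two_mul j)]; ring
    · intro j _
      rw [Odd.neg_pow (odd_two_mul_add_one j)]; ring
  rw [h1, add_comm (a ^ 2), add_pow]
  refine Finset.sum_le_sum fun j _ => ?_
  rw [← Nat.mul_sub, pow_mul b, pow_mul a, mul_pow]
  calc (b ^ 2) ^ j * (a ^ 2) ^ (k - j) * ((2 * k).choose (2 * j) : ℝ)
      ≤ (b ^ 2) ^ j * (a ^ 2) ^ (k - j) * (k.choose j * K ^ j) :=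
        mul_le_mul_of_nonneg_left (Nat.cast_choose_two_mul_le hK0 hK j) (by positivity)
    _ = _ := by ring

/-- A family of independent, mean zero random signs. -/
structure IsRademacherFamily {Ω ι : Type*} [MeasurableSpace Ω] (P : Measure Ω)
    (ε : ι → Ω → ℝ) : Prop where
  measurable : ∀ i, Measurable (ε i)
  eq_or : ∀ i ω, ε i ω = 1 ∨ ε i ω = -1
  integral_eq_zero : ∀ i, ∫ ω, ε i ω ∂P = 0
  indep : iIndepFun ε P

/-- The multilinear polynomial `∑_{T ⊆ S} a T ∏_{i ∈ T} ε i`. -/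
noncomputable def chaos {Ω ι : Type*} (ε : ι → Ω → ℝ) (S : Finset ι) (a : Finset ι → ℝ)
    (ω : Ω) : ℝ :=
  ∑ T ∈ S.powerset, a T * ∏ i ∈ T, ε i ω

section Chaos

variable {Ω ι : Type*} [MeasurableSpace Ω] {P : Measure Ω} {ε : ι → Ω → ℝ}

lemma chaos_insert {Ω ι : Type*} [DecidableEq ι] (ε : ι → Ω → ℝ) {S : Finset ι} {p : ι} (hp : p ∉ S)
    (a : Finset ι → ℝ) (ω : Ω) :
    chaos ε (insert p S) a ω =
      chaos ε S a ω + ε p ω * chaos ε S (fun T => a (insert p T)) ω := by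
  unfold chaos
  rw [Finset.sum_powerset_insert hp, Finset.mul_sum]
  congr 1
  refine Finset.sum_congr rfl fun T hT => ?_
  rw [Finset.prod_insert fun h => hp (Finset.mem_powerset.1 hT h)]
  ring

lemma IsRademacherFamily.abs_eq (h : IsRademacherFamily P ε) (i : ι) (ω : Ω) :
    |ε i ω| = 1 := by
  rcases h.eq_or i ω with h | h <;> simp [h]

lemma IsRademacherFamily.measurable_chaos (h : IsRademacherFamily P ε) (S : Finset ι)
    (a : Finset ι → ℝ) : Measurable (chaos ε S a) := by
  unfold chaos
  exact Finset.measurable_fun_sum _ fun T _ =>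
    (Finset.measurable_fun_prod _ fun i _ => h.measurable i).const_mul _

lemma IsRademacherFamily.abs_chaos_le (h : IsRademacherFamily P ε) (S : Finset ι)
    (a : Finset ι → ℝ) (ω : Ω) : |chaos ε S a ω| ≤ ∑ T ∈ S.powerset, |a T| := by
  refine (Finset.abs_sum_le_sum_abs _ _).trans_eq (Finset.sum_congr rfl fun T _ => ?_)
  rw [abs_mul, Finset.abs_prod, Finset.prod_congr rfl fun i _ => h.abs_eq i ω]
  simp

lemma integrable_pow_of_abs_le [IsFiniteMeasure P] {X : Ω → ℝ} (hX : Measurable X) {C : ℝ}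
    (hC : ∀ ω, |X ω| ≤ C) (n : ℕ) : Integrable (fun ω => X ω ^ n) P := by
  refine Integrable.of_bound (hX.pow_const n).aestronglyMeasurable (C ^ n)
    (Filter.Eventually.of_forall fun ω => ?_)
  rw [Real.norm_eq_abs, abs_pow]
  exact pow_le_pow_left₀ (abs_nonneg _) (hC ω) n

lemma IsRademacherFamily.integral_mul_eq_zero (h : IsRademacherFamily P ε) {S : Finset ι}
    {p : ι} (hp : p ∉ S) (a b : Finset ι → ℝ) {φ : ℝ × ℝ → ℝ} (hφ : Measurable φ) :
    ∫ ω, ε p ω * φ (chaos ε S a ω, chaos ε S b ω) ∂P = 0 := by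
  classical
  have hind := h.indep.indepFun_finset {p} S (by simpa using hp) h.measurable
  have hc : ∀ c : Finset ι → ℝ, ∃ ψ : (S → ℝ) → ℝ, Measurable ψ ∧
      ∀ ω, chaos ε S c ω = ψ (fun i : S => ε i ω) := by
    intro c
    refine ⟨fun v => ∑ T ∈ S.powerset, c T * ∏ i ∈ T, if hi : i ∈ S then v ⟨i, hi⟩ else 1,
      ?_, fun ω => ?_⟩
    · refine Finset.measurable_fun_sum _ fun T _ =>
        (Finset.measurable_fun_prod _ fun i _ => ?_).const_mul _
      split_ifs
      · exact measurable_pi_apply _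
      · exact measurable_const
    · refine Finset.sum_congr rfl fun T hT => ?_
      congr 1
      refine Finset.prod_congr rfl fun i hi => ?_
      rw [dif_pos (Finset.mem_powerset.1 hT hi)]
  obtain ⟨ψ₁, hψ₁, e₁⟩ := hc a
  obtain ⟨ψ₂, hψ₂, e₂⟩ := hc b
  have hev : Measurable fun v : (({p} : Finset ι) → ℝ) => v ⟨p, Finset.mem_singleton_self p⟩ :=
    measurable_pi_apply _
  have hind2 := hind.comp (ψ := fun v => φ (ψ₁ v, ψ₂ v)) hev (hφ.comp (hψ₁.prodMk hψ₂))
  have := hind2.integral_fun_mul_eq_mul_integral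
    (h.measurable p).aestronglyMeasurable
    ((hφ.comp (hψ₁.prodMk hψ₂)).comp (measurable_pi_lambda _ fun i : S =>
      h.measurable i)).aestronglyMeasurable
  simp only [Function.comp_apply] at this
  simp_rw [e₁, e₂]
  rw [this, h.integral_eq_zero p, zero_mul]

/-- Convexity of t ↦ t^k at A/α and B/β. Once integrated, it replaces Minkowski's inequality in the
inductive step below; the division is why α and β must be positive. -/
lemma add_mul_pow_le {k : ℕ} {K α β A B : ℝ} (hK : 0 ≤ K) (hα : 0 < α) (hβ : 0 < β)
    (hA : 0 ≤ A) (hB : 0 ≤ B) :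
    (A + K * B) ^ k ≤ (α + K * β) ^ k *
      (α / (α + K * β) * (A ^ k / α ^ k) + K * β / (α + K * β) * (B ^ k / β ^ k)) := by
  have hs : 0 < α + K * β := by positivity
  have hconv := (convexOn_pow k).2 (Set.mem_Ici.2 (div_nonneg hA hα.le))
    (Set.mem_Ici.2 (div_nonneg hB hβ.le)) (div_nonneg hα.le hs.le)
    (div_nonneg (mul_nonneg hK hβ.le) hs.le) (by field_simp)
  simp only [smul_eq_mul] at hconv
  have e : α / (α + K * β) * (A / α) + K * β / (α + K * β) * (B / β) =
      (A + K * B) / (α + K * β) := by field_simp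
  rw [e, div_pow, div_pow, div_pow, div_le_iff₀ (by positivity)] at hconv
  linarith

/-- Induction on S: split off one sign, average over it with the two-point inequality, and recombine
by convexity. The strictly positive majorant b of a² keeps both weights nonzero; a limit b → a²
removes it afterwards. -/
lemma IsRademacherFamily.integral_chaos_pow_le_of_pos [IsProbabilityMeasure P]
    (h : IsRademacherFamily P ε) {k : ℕ} {K : ℝ} (hK0 : 0 ≤ K) (hK : 2 * (k : ℝ) - 1 ≤ K)
    (S : Finset ι) (a b : Finset ι → ℝ) (hb : ∀ T, 0 < b T) (hab : ∀ T, a T ^ 2 ≤ b T) :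
    ∫ ω, chaos ε S a ω ^ (2 * k) ∂P ≤ (∑ T ∈ S.powerset, b T * K ^ T.card) ^ k := by
  classical
  induction S using Finset.induction_on generalizing a b with
  | empty =>
    simp only [chaos, Finset.powerset_empty, Finset.sum_singleton, Finset.prod_empty, mul_one,
      integral_const, probReal_univ, smul_eq_mul, one_mul, Finset.card_empty, pow_zero]
    rw [pow_mul]
    exact pow_le_pow_left₀ (sq_nonneg _) (hab ∅) _
  | insert p S hp ih =>
    set A := chaos ε S a
    set B := chaos ε S (fun T => a (insert p T))
    set α := ∑ T ∈ S.powerset, b T * K ^ T.card with hα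
    set β := ∑ T ∈ S.powerset, b (insert p T) * K ^ T.card with hβ
    have hsum_pos : ∀ c : Finset ι → ℝ, (∀ T, 0 < c T) →
        0 < ∑ T ∈ S.powerset, c T * K ^ T.card := fun c hc => by
      refine Finset.sum_pos' (fun T _ => mul_nonneg (hc T).le (by positivity))
        ⟨∅, by simp, by simpa using hc ∅⟩
    have hα0 : 0 < α := hsum_pos b hb
    have hβ0 : 0 < β := hsum_pos (fun T => b (insert p T)) fun T => hb _
    have ihA := ih a b hb hab
    have ihB := ih (fun T => a (insert p T)) (fun T => b (insert p T)) (fun T => hb _)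
      fun T => hab _
    rw [← hα] at ihA
    rw [← hβ] at ihB
    have hsum : ∑ T ∈ (insert p S).powerset, b T * K ^ T.card = α + K * β := by
      rw [Finset.sum_powerset_insert hp, hα, hβ, Finset.mul_sum]
      congr 1
      refine Finset.sum_congr rfl fun T hT => ?_
      rw [Finset.card_insert_of_notMem fun h => hp (Finset.mem_powerset.1 hT h)]
      ring
    have hAm : Measurable A := h.measurable_chaos S a
    have hBm : Measurable B := h.measurable_chaos S _
    have hAb := h.abs_chaos_le S a
    have hBb := h.abs_chaos_le S (fun T => a (insert p T))
    have hAi : Integrable (fun ω => A ω ^ (2 * k)) P := integrable_pow_of_abs_le hAm hAb _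
    have hBi : Integrable (fun ω => B ω ^ (2 * k)) P := integrable_pow_of_abs_le hBm hBb _
    have hpi : Integrable (fun ω => (A ω + B ω) ^ (2 * k)) P :=
      integrable_pow_of_abs_le (hAm.add hBm)
        (fun ω => (abs_add_le _ _).trans (add_le_add (hAb ω) (hBb ω))) _
    have hmi : Integrable (fun ω => (A ω - B ω) ^ (2 * k)) P :=
      integrable_pow_of_abs_le (hAm.sub hBm)
        (fun ω => (abs_sub _ _).trans (add_le_add (hAb ω) (hBb ω))) _
    -- The even part in ε p plus ε p times a function of the other signs; by independence the second
    -- term has mean zero.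
    have hdecomp : ∀ ω, chaos ε (insert p S) a ω ^ (2 * k) =
        ((A ω + B ω) ^ (2 * k) + (A ω - B ω) ^ (2 * k)) / 2 +
          ε p ω * (((A ω + B ω) ^ (2 * k) - (A ω - B ω) ^ (2 * k)) / 2) := by
      intro ω
      rw [chaos_insert ε hp]
      rcases h.eq_or p ω with e | e
      · rw [e]; simp only [A, B]; ring
      · rw [e]; simp only [A, B]; ring
    have hzero := h.integral_mul_eq_zero hp a (fun T => a (insert p T))
      (φ := fun z => ((z.1 + z.2) ^ (2 * k) - (z.1 - z.2) ^ (2 * k)) / 2) (by fun_prop)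
    have hεi : Integrable (fun ω => ε p ω *
        (((A ω + B ω) ^ (2 * k) - (A ω - B ω) ^ (2 * k)) / 2)) P :=
      ((hpi.sub hmi).div_const 2).bdd_mul (c := 1) (h.measurable p).aestronglyMeasurable
        (Filter.Eventually.of_forall fun ω => by rw [Real.norm_eq_abs, h.abs_eq])
    rw [hsum]
    simp_rw [hdecomp]
    have hUi : Integrable (fun ω => ((A ω + B ω) ^ (2 * k) + (A ω - B ω) ^ (2 * k)) / 2) P :=
      (hpi.add hmi).div_const 2
    rw [integral_add hUi hεi, hzero, add_zero]
    set s := α + K * β with hs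
    have hs0 : 0 < s := by positivity
    calc ∫ ω, ((A ω + B ω) ^ (2 * k) + (A ω - B ω) ^ (2 * k)) / 2 ∂P
        ≤ ∫ ω, s ^ k * (α / s * (A ω ^ (2 * k) / α ^ k) +
            K * β / s * (B ω ^ (2 * k) / β ^ k)) ∂P := by
          refine integral_mono hUi
            ((((hAi.div_const _).const_mul _).add ((hBi.div_const _).const_mul _)).const_mul _)
            fun ω => ?_
          refine (two_point_inequality hK0 hK _ _).trans ?_
          have := add_mul_pow_le (k := k) hK0 hα0 hβ0 (sq_nonneg (A ω)) (sq_nonneg (B ω))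
          rwa [← pow_mul, ← pow_mul] at this
      _ = s ^ k * (α / s * ((∫ ω, A ω ^ (2 * k) ∂P) / α ^ k) +
            K * β / s * ((∫ ω, B ω ^ (2 * k) ∂P) / β ^ k)) := by
          rw [integral_const_mul, integral_add ((hAi.div_const _).const_mul _)
            ((hBi.div_const _).const_mul _), integral_const_mul, integral_const_mul,
            integral_div, integral_div]
      _ ≤ s ^ k * (α / s * 1 + K * β / s * 1) := by
          gcongr
          · exact div_le_one_of_le₀ ihA (by positivity)
          · exact div_le_one_of_le₀ ihB (by positivity)
      _ = s ^ k := by rw [mul_one, mul_one, ← add_div, ← hs, div_self hs0.ne', mul_one]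

/-- The Bonami hypercontractive inequality for even moments. -/
theorem IsRademacherFamily.integral_chaos_pow_le [IsProbabilityMeasure P]
    (h : IsRademacherFamily P ε) {k : ℕ} {K : ℝ} (hK0 : 0 ≤ K) (hK : 2 * (k : ℝ) - 1 ≤ K)
    (S : Finset ι) (a : Finset ι → ℝ) :
    ∫ ω, chaos ε S a ω ^ (2 * k) ∂P ≤ (∑ T ∈ S.powerset, a T ^ 2 * K ^ T.card) ^ k := by
  have hcont : Continuous fun η : ℝ =>
      (∑ T ∈ S.powerset, (a T ^ 2 + η) * K ^ T.card) ^ k := by fun_prop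
  have hlim := (hcont.tendsto 0).mono_left (nhdsWithin_le_nhds (s := Set.Ioi 0))
  simp only [add_zero] at hlim
  refine ge_of_tendsto hlim (Filter.eventually_of_mem self_mem_nhdsWithin fun η hη => ?_)
  have hη : 0 < η := hη
  exact h.integral_chaos_pow_le_of_pos hK0 hK S a (fun T => a T ^ 2 + η)
    (fun T => by positivity) fun T => by linarith

end Chaos

/-! ### A maximal inequality -/

/-- Take m to be the first index at which the running sum reaches half the total. Dropping m itself
leaves at most half on either side. -/
lemma exists_half_split (b : ℕ → ℝ) (hb : ∀ n, 0 ≤ b n) {a c : ℕ} (hac : a < c) :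
    ∃ m, a ≤ m ∧ m < c ∧ ∑ n ∈ Finset.Ico a m, b n ≤ (∑ n ∈ Finset.Ico a c, b n) / 2 ∧
      ∑ n ∈ Finset.Ico (m + 1) c, b n ≤ (∑ n ∈ Finset.Ico a c, b n) / 2 := by
  classical
  set g := ∑ n ∈ Finset.Ico a c, b n with hg
  have hg0 : 0 ≤ g := Finset.sum_nonneg fun n _ => hb n
  have hex : ∃ m, a ≤ m ∧ g / 2 ≤ ∑ n ∈ Finset.Ico a (m + 1), b n :=
    ⟨c - 1, by omega, by rw [Nat.sub_add_cancel (by omega), ← hg]; linarith⟩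
  obtain ⟨h1, h2⟩ := Nat.find_spec hex
  have hlt : Nat.find hex ≤ c - 1 := Nat.find_min' hex
    ⟨by omega, by rw [Nat.sub_add_cancel (by omega), ← hg]; linarith⟩
  refine ⟨Nat.find hex, h1, by omega, ?_, ?_⟩
  · rcases h1.eq_or_lt with h | h
    · rw [← h]; simp; positivity
    · have := Nat.find_min hex (m := Nat.find hex - 1) (by omega)
      rw [not_and, Nat.sub_add_cancel (by omega)] at this
      exact (not_le.1 (this (by omega))).le
  · have := Finset.sum_Ico_consecutive b (m := a) (n := Nat.find hex + 1) (k := c) (by omega)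
      (by omega)
    linarith

/-- Convexity with weights 1/5 and 4/5. The uneven split makes the factor on v grow like (25/16)^k,
so the gain 2^(-k) from halving a block beats it. -/
lemma add_pow_even_le (k : ℕ) (hk : 1 ≤ k) (u v : ℝ) :
    (u + v) ^ (2 * k) ≤ 5 ^ (2 * k - 1) * u ^ (2 * k) + (5 / 4) ^ (2 * k - 1) * v ^ (2 * k) := by
  have := (Even.convexOn_pow (𝕜 := ℝ) (even_two_mul k)).2 (Set.mem_univ (5 * u))
    (Set.mem_univ (5 / 4 * v)) (show (0 : ℝ) ≤ 1 / 5 by norm_num)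
    (show (0 : ℝ) ≤ 4 / 5 by norm_num) (by norm_num)
  simp only [smul_eq_mul] at this
  rw [show 1 / 5 * (5 * u) + 4 / 5 * (5 / 4 * v) = u + v by ring, mul_pow, mul_pow] at this
  obtain ⟨m, hm⟩ : ∃ m, 2 * k = m + 1 := ⟨2 * k - 1, by omega⟩
  rw [hm] at this ⊢
  rw [Nat.add_sub_cancel]
  calc _ ≤ _ := this
    _ = _ := by rw [pow_succ 5, pow_succ (5 / 4 : ℝ)]; ring

lemma five_div_four_pow_le {k : ℕ} (hk : 5 ≤ k) : ((5 : ℝ) / 4) ^ (2 * k - 1) * 4 ≤ 2 ^ k := by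
  induction k, hk using Nat.le_induction with
  | base => norm_num
  | succ n hn ih =>
    rw [show 2 * (n + 1) - 1 = 2 * n - 1 + 2 by omega, pow_add, pow_succ 2 n]
    have : (0 : ℝ) < (5 / 4) ^ (2 * n - 1) := by positivity
    nlinarith

/-- A maximal inequality of Móricz type: moment bounds for all consecutive blocks yield a moment
bound for the maximal block. -/
theorem exists_maximal_bound {Ω : Type*} [MeasurableSpace Ω] {P : Measure Ω} {k : ℕ}
    (hk : 5 ≤ k) (X : ℕ → Ω → ℝ) (b : ℕ → ℝ) (hb : ∀ n, 0 ≤ b n)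
    (hint : ∀ a c, Integrable (fun ω => (∑ n ∈ Finset.Ico a c, X n ω) ^ (2 * k)) P)
    (hmom : ∀ a c, ∫ ω, (∑ n ∈ Finset.Ico a c, X n ω) ^ (2 * k) ∂P ≤
      (∑ n ∈ Finset.Ico a c, b n) ^ k) (a c : ℕ) :
    ∃ Φ : Ω → ℝ, Integrable Φ P ∧ (∀ ω, 0 ≤ Φ ω) ∧
      (∀ ω, ∀ j ≤ c, (∑ n ∈ Finset.Ico a j, X n ω) ^ (2 * k) ≤ Φ ω) ∧
      ∫ ω, Φ ω ∂P ≤ 25 ^ k * (∑ n ∈ Finset.Ico a c, b n) ^ k := by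
  induction hd : c - a using Nat.strong_induction_on generalizing a c with
  | _ d ih =>
    subst hd
    rcases le_or_gt c a with hca | hac
    · refine ⟨0, integrable_zero _ _ _, fun _ => le_rfl, fun ω j hj => ?_, ?_⟩
      · rw [Finset.Ico_eq_empty (by omega)]
        rw [Finset.sum_empty, zero_pow (by omega)]; rfl
      · simp only [Pi.zero_apply, integral_zero]
        exact mul_nonneg (by positivity)
          (pow_nonneg (Finset.sum_nonneg fun n _ => hb n) _)
    · obtain ⟨m, ham, hmc, hg1, hg2⟩ := exists_half_split b hb hac
      obtain ⟨Φ₁, i₁, p₁, b₁, m₁⟩ := ih (m - a) (by omega) a m rfl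
      obtain ⟨Φ₂, i₂, p₂, b₂, m₂⟩ := ih (c - (m + 1)) (by omega) (m + 1) c rfl
      set g := ∑ n ∈ Finset.Ico a c, b n with hg
      have hg0 : 0 ≤ g := Finset.sum_nonneg fun n _ => hb n
      set q := 2 * k - 1 with hq
      have hev : ∀ z : ℝ, 0 ≤ z ^ (2 * k) := fun z => (even_two_mul k).pow_nonneg z
      have h54 : (1 : ℝ) ≤ (5 / 4) ^ q := one_le_pow₀ (by norm_num)
      -- For j ≤ m the bound Φ₁ suffices. For j > m the sum splits at m + 1 into a fixed block and
      -- an initial segment of the right half, controlled by Φ₂.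
      refine ⟨fun ω => 5 ^ q * (∑ n ∈ Finset.Ico a (m + 1), X n ω) ^ (2 * k) +
        (5 / 4) ^ q * (Φ₁ ω + Φ₂ ω), ((hint _ _).const_mul _).add ((i₁.add i₂).const_mul _),
        fun ω => ?_, fun ω j hj => ?_, ?_⟩
      · have := p₁ ω
        have := p₂ ω
        have := hev (∑ n ∈ Finset.Ico a (m + 1), X n ω)
        positivity
      · have h1 := p₁ ω
        have h2 := p₂ ω
        rcases le_or_gt j m with hjm | hjm
        · have := b₁ ω j hjm
          have := hev (∑ n ∈ Finset.Ico a (m + 1), X n ω)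
          have : (0 : ℝ) ≤ 5 ^ q * (∑ n ∈ Finset.Ico a (m + 1), X n ω) ^ (2 * k) := by positivity
          nlinarith
        · rw [← Finset.sum_Ico_consecutive (fun n => X n ω) (m := a) (n := m + 1) (k := j)
            (by omega) (by omega)]
          refine (add_pow_even_le k (by omega) _ _).trans (add_le_add le_rfl ?_)
          exact mul_le_mul_of_nonneg_left (by linarith [b₂ ω j hj]) (by positivity)
      · have i₃ : Integrable (fun ω => (5 / 4 : ℝ) ^ q * (Φ₁ ω + Φ₂ ω)) P :=
          (i₁.add i₂).const_mul _
        rw [integral_add ((hint a (m + 1)).const_mul _) i₃, integral_const_mul,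
          integral_const_mul, integral_add i₁ i₂]
        have e1 : ∑ n ∈ Finset.Ico a (m + 1), b n ≤ g :=
          Finset.sum_le_sum_of_subset_of_nonneg (Finset.Ico_subset_Ico le_rfl (by omega))
            fun n _ _ => hb n
        have e2 := (hmom a (m + 1)).trans
          (pow_le_pow_left₀ (Finset.sum_nonneg fun n _ => hb n) e1 k)
        have e3 : ∫ ω, Φ₁ ω ∂P ≤ 25 ^ k * (g / 2) ^ k := m₁.trans (by
          gcongr
          exact Finset.sum_nonneg fun n _ => hb n)
        have e4 : ∫ ω, Φ₂ ω ∂P ≤ 25 ^ k * (g / 2) ^ k := m₂.trans (by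
          gcongr
          exact Finset.sum_nonneg fun n _ => hb n)
        -- The fixed block costs 25^k / 5 and the two halves together at most 25^k / 2, so the
        -- constant 25^k reproduces itself.
        have h5 := five_div_four_pow_le hk
        have h25 : (5 : ℝ) ^ q * 5 = 25 ^ k := by
          rw [← pow_succ, hq, Nat.sub_add_cancel (by omega), pow_mul]; norm_num
        have hgk : 0 ≤ g ^ k := by positivity
        calc 5 ^ q * ∫ ω, (∑ n ∈ Finset.Ico a (m + 1), X n ω) ^ (2 * k) ∂P +
              (5 / 4) ^ q * (∫ ω, Φ₁ ω ∂P + ∫ ω, Φ₂ ω ∂P)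
            ≤ 5 ^ q * g ^ k + (5 / 4) ^ q * (25 ^ k * (g / 2) ^ k + 25 ^ k * (g / 2) ^ k) := by
              gcongr
          _ = 5 ^ q * g ^ k + ((5 / 4) ^ q * 4 / 2 ^ k) * (25 ^ k * g ^ k) / 2 := by
              rw [div_pow g 2 k]; ring
          _ ≤ 5 ^ q * g ^ k + 1 * (25 ^ k * g ^ k) / 2 := by
              gcongr
              exact div_le_one_of_le₀ h5 (by positivity)
          _ ≤ 25 ^ k * g ^ k := by
              rw [← h25]
              have : 0 ≤ 5 ^ q * g ^ k := by positivity
              nlinarith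

/-! ### Maximal hypercontractivity and sub-Gaussian tails -/

section ChaosMaximal

variable {Ω ι : Type*} [MeasurableSpace Ω] {P : Measure Ω} {ε : ι → Ω → ℝ}

lemma chaos_sum {Ω ι α : Type*} (ε : ι → Ω → ℝ) (S : Finset ι) (s : Finset α)
    (a : α → Finset ι → ℝ) (ω : Ω) :
    ∑ n ∈ s, chaos ε S (a n) ω = chaos ε S (fun T => ∑ n ∈ s, a n T) ω := by
  unfold chaos
  rw [Finset.sum_comm]
  exact Finset.sum_congr rfl fun T _ => (Finset.sum_mul _ _ _).symm

/-- Maximal version of hypercontractivity: the monomials are ordered by a label `w`. -/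
theorem IsRademacherFamily.exists_chaos_maximal_bound [IsProbabilityMeasure P]
    (h : IsRademacherFamily P ε) {k : ℕ} (hk : 5 ≤ k) {K : ℝ} (hK : 2 * (k : ℝ) - 1 ≤ K)
    (S : Finset ι) (a : Finset ι → ℝ) (w : Finset ι → ℕ) (A c : ℕ) :
    ∃ Φ : Ω → ℝ, Integrable Φ P ∧ (∀ ω, 0 ≤ Φ ω) ∧
      (∀ ω, ∀ j ≤ c, chaos ε S (fun T => if w T ∈ Finset.Ico A j then a T else 0) ω ^ (2 * k) ≤
        Φ ω) ∧
      ∫ ω, Φ ω ∂P ≤ 25 ^ k *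
        (∑ T ∈ S.powerset, if w T ∈ Finset.Ico A c then a T ^ 2 * K ^ T.card else 0) ^ k := by
  have hk5 : (5 : ℝ) ≤ k := by exact_mod_cast hk
  have hK0 : 0 ≤ K := by linarith
  have hX : ∀ i j ω, ∑ n ∈ Finset.Ico i j, chaos ε S (fun T => if w T = n then a T else 0) ω =
      chaos ε S (fun T => if w T ∈ Finset.Ico i j then a T else 0) ω := fun i j ω => by
    rw [chaos_sum]
    simp_rw [Finset.sum_ite_eq]
  have hb : ∀ i j, ∑ n ∈ Finset.Ico i j, ∑ T ∈ S.powerset,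
      (if w T = n then a T ^ 2 * K ^ T.card else 0) =
      ∑ T ∈ S.powerset, if w T ∈ Finset.Ico i j then a T ^ 2 * K ^ T.card else 0 := fun i j => by
    rw [Finset.sum_comm]
    simp_rw [Finset.sum_ite_eq]
  have := exists_maximal_bound (P := P) hk
    (fun n ω => chaos ε S (fun T => if w T = n then a T else 0) ω)
    (fun n => ∑ T ∈ S.powerset, if w T = n then a T ^ 2 * K ^ T.card else 0)
    (fun n => Finset.sum_nonneg fun T _ => by split_ifs <;> positivity)
    (fun i j => by
      simp_rw [hX]
      exact integrable_pow_of_abs_le (h.measurable_chaos S _) (h.abs_chaos_le S _) _)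
    (fun i j => by
      simp_rw [hX, hb]
      refine (h.integral_chaos_pow_le hK0 hK S _).trans_eq ?_
      congr 1
      refine Finset.sum_congr rfl fun T _ => ?_
      split_ifs <;> simp) A c
  simp_rw [hX, hb] at this
  exact this

lemma IsRademacherFamily.hasSubgaussianMGF_const_mul [IsProbabilityMeasure P]
    (h : IsRademacherFamily P ε) (i : ι) (v : ℝ) :
    HasSubgaussianMGF (fun ω => v * ε i ω) (‖v‖₊ ^ 2) P := by
  have := hasSubgaussianMGF_of_mem_Icc_of_integral_eq_zero (μ := P)
    (X := fun ω => v * ε i ω) (a := -|v|) (b := |v|)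
    ((h.measurable i).const_mul v).aemeasurable
    (Filter.Eventually.of_forall fun ω => by
      rw [Set.mem_Icc, ← abs_le, abs_mul, h.abs_eq, mul_one])
    (by rw [integral_const_mul, h.integral_eq_zero, mul_zero])
  convert this using 1
  apply NNReal.coe_injective
  push_cast
  rw [Real.norm_eq_abs, Real.norm_eq_abs, show |v| - -|v| = 2 * |v| by ring, abs_mul, abs_abs]
  norm_num

lemma IsRademacherFamily.measureReal_sum_le_neg [IsProbabilityMeasure P]
    (h : IsRademacherFamily P ε) (S : Finset ι) (u : ι → ℝ) {V r : ℝ}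
    (hV : ∑ i ∈ S, u i ^ 2 ≤ V) (hr : 0 ≤ r) :
    P.real {ω | ∑ i ∈ S, u i * ε i ω ≤ -r} ≤ Real.exp (-r ^ 2 / (2 * V)) := by
  have hV0 : 0 ≤ V := (Finset.sum_nonneg fun i _ => sq_nonneg (u i)).trans hV
  have hind : iIndepFun (fun i ω => -u i * ε i ω) P :=
    h.indep.comp (fun i z => -u i * z) fun i => by fun_prop
  have hs := HasSubgaussianMGF.sum_of_iIndepFun hind (s := S)
    fun i _ => h.hasSubgaussianMGF_const_mul i (-u i)
  -- The variance proxies of independent summands add; the sum is then relaxed to V.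
  have hs' : HasSubgaussianMGF (fun ω => ∑ i ∈ S, -u i * ε i ω) ⟨V, hV0⟩ P := by
    refine ⟨hs.integrable_exp_mul, fun t => (hs.mgf_le t).trans ?_⟩
    have : ((∑ i ∈ S, ‖-u i‖₊ ^ 2 : NNReal) : ℝ) ≤ V := by
      push_cast
      simpa using hV
    refine Real.exp_le_exp.2 ?_
    change _ ≤ V * t ^ 2 / 2
    gcongr
  refine le_trans (le_of_eq ?_) (hs'.measure_ge_le hr)
  congr 1
  ext ω
  simp only [Set.mem_ofPred_eq, neg_mul, Finset.sum_neg_distrib]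
  exact le_neg

end ChaosMaximal

/-! ### Sums over squarefree smooth numbers -/

/-- The finite set of primes `p ≤ N`. -/
def primesUpTo (N : ℕ) : Finset {p : ℕ // p.Prime} := (Finset.range (N + 1)).subtype Nat.Prime

lemma mem_primesUpTo {N : ℕ} {p : {p : ℕ // p.Prime}} : p ∈ primesUpTo N ↔ (p : ℕ) ≤ N := by
  rw [primesUpTo, Finset.mem_subtype, Finset.mem_range, Nat.lt_succ_iff]

/-- The product of a finite set of primes. -/
def primeProd (T : Finset {p : ℕ // p.Prime}) : ℕ := ∏ p ∈ T, (p : ℕ)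

lemma primeProd_pos (T : Finset {p : ℕ // p.Prime}) : 0 < primeProd T :=
  Finset.prod_pos fun p _ => p.2.pos

lemma primeProd_eq_prod_map (T : Finset {p : ℕ // p.Prime}) :
    primeProd T = ∏ p ∈ T.map (Function.Embedding.subtype Nat.Prime), p := by
  rw [Finset.prod_map]; rfl

lemma primeFactors_primeProd (T : Finset {p : ℕ // p.Prime}) :
    (primeProd T).primeFactors = T.map (Function.Embedding.subtype Nat.Prime) := by
  rw [primeProd_eq_prod_map, Nat.primeFactors_prod]
  intro p hp
  obtain ⟨q, -, rfl⟩ := Finset.mem_map.1 hp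
  exact q.2

lemma subtype_primeFactors_primeProd (T : Finset {p : ℕ // p.Prime}) :
    (primeProd T).primeFactors.subtype Nat.Prime = T := by
  rw [primeFactors_primeProd]
  ext p
  simpa using fun _ => p.2

lemma primeProd_injective : Function.Injective primeProd := fun T U h => by
  rw [← subtype_primeFactors_primeProd T, h, subtype_primeFactors_primeProd]

lemma squarefree_primeProd (T : Finset {p : ℕ // p.Prime}) : Squarefree (primeProd T) := by
  rw [primeProd]
  refine Finset.squarefree_prod_of_pairwise_isCoprime ?_ fun p _ => p.2.squarefree
  intro p _ q _ hpq
  exact Nat.coprime_iff_isRelPrime.1 ((Nat.coprime_primes p.2 q.2).2 fun h => hpq (Subtype.ext h))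

lemma primeProd_subtype_primeFactors {n : ℕ} (hn : Squarefree n) :
    primeProd (n.primeFactors.subtype Nat.Prime) = n := by
  rw [primeProd_eq_prod_map, Finset.subtype_map,
    Finset.filter_true_of_mem fun p hp => Nat.prime_of_mem_primeFactors hp]
  exact Nat.prod_primeFactors_of_squarefree hn

lemma primeProd_rpow (T : Finset {p : ℕ // p.Prime}) (s : ℝ) :
    (primeProd T : ℝ) ^ s = ∏ p ∈ T, ((p : ℕ) : ℝ) ^ s := by
  rw [primeProd, Nat.cast_prod, Real.finsetProd_rpow _ _ fun p _ => by positivity]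

lemma primeProd_le {S T : Finset {p : ℕ // p.Prime}} (h : T ⊆ S) : primeProd T ≤ primeProd S :=
  Nat.le_of_dvd (primeProd_pos S) (Finset.prod_dvd_prod_of_subset _ _ _ h)

lemma chaos_primeProd_eq_prod {Ω : Type*} (ε : {p : ℕ // p.Prime} → Ω → ℝ) (S : Finset {p : ℕ // p.Prime})
    (s : ℝ) (ω : Ω) :
    chaos ε S (fun T => (primeProd T : ℝ) ^ s) ω =
      ∏ p ∈ S, (1 + ((p : ℕ) : ℝ) ^ s * ε p ω) := by
  classical
  rw [Finset.prod_one_add, chaos]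
  refine Finset.sum_congr rfl fun T _ => ?_
  rw [primeProd_rpow, Finset.prod_mul_distrib]

lemma prod_one_add_mul_primes (S : Finset {p : ℕ // p.Prime}) (K s : ℝ) :
    ∏ p ∈ S, (1 + K * ((p : ℕ) : ℝ) ^ s) =
      ∑ T ∈ S.powerset, (primeProd T : ℝ) ^ s * K ^ T.card := by
  classical
  rw [Finset.prod_one_add]
  refine Finset.sum_congr rfl fun T _ => ?_
  rw [primeProd_rpow, Finset.prod_mul_distrib, Finset.prod_const, mul_comm]

/-- Squarefree n correspond to finite sets of primes, and the other n contribute zero through μ.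
Since ⌊y⌋ ≤ N, no prime above N occurs. -/
lemma weightedPartialSum_eq_chaos {Ω : Type*} {f : ℕ → Ω → ℝ} {ε : {p : ℕ // p.Prime} → Ω → ℝ} {ω : Ω}
    (hf : ∀ n : ℕ, 1 ≤ n →
      f n ω = (ArithmeticFunction.moebius n : ℝ) ^ 2 * ∏ p ∈ n.primeFactors, f p ω)
    (hε : ∀ p : {p : ℕ // p.Prime}, f p ω = ε p ω) {N : ℕ} {σ y : ℝ} (hy : ⌊y⌋₊ ≤ N) :
    weightedPartialSum f σ y ω = chaos ε (primesUpTo N)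
      (fun T => if primeProd T ≤ ⌊y⌋₊ then (primeProd T : ℝ) ^ (-σ) else 0) ω := by
  classical
  unfold weightedPartialSum chaos
  simp_rw [ite_mul, zero_mul]
  rw [← Finset.sum_filter, ← Finset.sum_filter_of_ne (p := Squarefree)]
  swap
  · intro n hn hne
    by_contra hsq
    rw [hf n (Finset.mem_Icc.1 hn).1, ArithmeticFunction.moebius_eq_zero_of_not_squarefree hsq]
      at hne
    simp at hne
  refine Finset.sum_bij' (fun n _ => n.primeFactors.subtype Nat.Prime) (fun T _ => primeProd T)
    ?_ ?_ ?_ ?_ ?_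
  · intro n hn
    obtain ⟨hn, hsq⟩ := Finset.mem_filter.1 hn
    obtain ⟨hn1, hny⟩ := Finset.mem_Icc.1 hn
    rw [Finset.mem_filter, Finset.mem_powerset, primeProd_subtype_primeFactors hsq]
    refine ⟨fun p hp => mem_primesUpTo.2 ?_, hny⟩
    rw [Finset.mem_subtype] at hp
    exact ((Nat.le_of_mem_primeFactors hp).trans hny).trans hy
  · intro T hT
    obtain ⟨-, hT⟩ := Finset.mem_filter.1 hT
    exact Finset.mem_filter.2 ⟨Finset.mem_Icc.2 ⟨primeProd_pos T, hT⟩, squarefree_primeProd T⟩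
  · intro n hn
    exact primeProd_subtype_primeFactors (Finset.mem_filter.1 hn).2
  · intro T _
    exact subtype_primeFactors_primeProd T
  · intro n hn
    obtain ⟨hn, hsq⟩ := Finset.mem_filter.1 hn
    rw [primeProd_subtype_primeFactors hsq, hf n (Finset.mem_Icc.1 hn).1,
      ← Int.cast_pow, ArithmeticFunction.moebius_sq_eq_one_of_squarefree hsq,
      Real.rpow_neg (Nat.cast_nonneg n), div_eq_mul_inv, mul_comm]
    congr 1
    rw [Int.cast_one, one_mul]
    conv_lhs => rw [← primeProd_subtype_primeFactors hsq, primeFactors_primeProd, Finset.prod_map]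
    exact Finset.prod_congr rfl fun p _ => hε p

/-! ### Euler product bounds and Rankin's trick -/

lemma sum_Icc_rpow_neg_le {s : ℝ} (hs : 1 < s) (M : ℕ) :
    ∑ n ∈ Finset.Icc 1 M, (n : ℝ) ^ (-s) ≤ 1 + 1 / (s - 1) := by
  have hs1 : 0 < s - 1 := by linarith
  rcases Nat.eq_zero_or_pos M with rfl | hM
  · simp; positivity
  rw [← Finset.add_sum_Ioc_eq_sum_Icc hM, Nat.cast_one, Real.one_rpow]
  gcongr
  have hanti : AntitoneOn (fun x : ℝ => x ^ (-s)) (Set.Icc ((1 : ℕ) : ℝ) M) := by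
    intro x hx y hy hxy
    have : (0 : ℝ) < x := lt_of_lt_of_le (by norm_num) hx.1
    exact Real.rpow_le_rpow_of_nonpos this hxy (by linarith)
  have h := hanti.sum_le_integral_Ico hM
  rw [integral_rpow (Or.inr ⟨by linarith, by
    rw [Set.uIcc_of_le (by exact_mod_cast hM)]; simp⟩)] at h
  have e : ∑ n ∈ Finset.Ioc 1 M, (n : ℝ) ^ (-s) =
      ∑ i ∈ Finset.Ico 1 M, ((i + 1 : ℕ) : ℝ) ^ (-s) := by
    rw [Finset.sum_Ico_add' (fun n : ℕ => (n : ℝ) ^ (-s)) 1 M 1]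
    refine Finset.sum_congr ?_ fun _ _ => rfl
    ext n; simp only [Finset.mem_Ioc, Finset.mem_Ico]; omega
  rw [e]
  refine h.trans ?_
  rw [Nat.cast_one, Real.one_rpow, ← neg_div_neg_eq,
    show -(-s + 1) = s - 1 by ring]
  gcongr
  have : (0 : ℝ) ≤ (M : ℝ) ^ (-s + 1) := by positivity
  linarith

/-- The expanded product is a sum of n^(-s) over distinct integers n, hence bounded by a partial sum
of ζ(s). -/
lemma prod_one_add_primes_le {s : ℝ} (hs : 1 < s) (S : Finset {p : ℕ // p.Prime}) :
    ∏ p ∈ S, (1 + ((p : ℕ) : ℝ) ^ (-s)) ≤ 1 + 1 / (s - 1) := by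
  classical
  have h := prod_one_add_mul_primes S 1 (-s)
  simp only [one_mul, one_pow, mul_one] at h
  rw [h]
  refine le_trans ?_ (sum_Icc_rpow_neg_le hs (primeProd S))
  rw [← Finset.sum_image (s := S.powerset) (g := primeProd) (f := fun n : ℕ => (n : ℝ) ^ (-s))
    (primeProd_injective.injOn)]
  refine Finset.sum_le_sum_of_subset_of_nonneg ?_ fun n _ _ => by positivity
  intro n hn
  obtain ⟨T, hT, rfl⟩ := Finset.mem_image.1 hn
  exact Finset.mem_Icc.2 ⟨primeProd_pos T, primeProd_le (Finset.mem_powerset.1 hT)⟩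

lemma prime_rpow_neg_le_one {s : ℝ} (hs : 0 ≤ s) (p : {p : ℕ // p.Prime}) :
    ((p : ℕ) : ℝ) ^ (-s) ≤ 1 :=
  Real.rpow_le_one_of_one_le_of_nonpos (by exact_mod_cast p.2.one_lt.le) (by linarith)

/-- Logarithm of the product bound; the factor 2 comes from exp(u/2) ≤ 1 + u on [0, 1]. -/
lemma sum_primes_rpow_neg_le {s : ℝ} (hs : 1 < s) (S : Finset {p : ℕ // p.Prime}) :
    ∑ p ∈ S, ((p : ℕ) : ℝ) ^ (-s) ≤ 2 * Real.log (1 + 1 / (s - 1)) := by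
  have hs1 : 0 < s - 1 := by linarith
  have h := prod_one_add_primes_le hs S
  have h2 : Real.exp (∑ p ∈ S, ((p : ℕ) : ℝ) ^ (-s) / 2) ≤ 1 + 1 / (s - 1) := by
    rw [Real.exp_sum]
    refine le_trans (Finset.prod_le_prod (fun _ _ => (Real.exp_pos _).le) fun p _ => ?_) h
    set u := ((p : ℕ) : ℝ) ^ (-s)
    have hu0 : 0 ≤ u := by positivity
    have hu1 : u ≤ 1 := prime_rpow_neg_le_one (by linarith) p
    have h3 := Real.one_sub_le_exp_neg (u / 2)
    rw [Real.exp_neg, le_inv_comm₀ (by linarith) (Real.exp_pos _)] at h3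
    refine h3.trans ?_
    rw [inv_le_iff_one_le_mul₀ (by linarith)]
    nlinarith
  rw [← Real.le_log_iff_exp_le (by positivity), ← Finset.sum_div] at h2
  linarith

/-- Bernoulli's inequality, 1 + K u ≤ (1 + u)^K, applied at each prime. -/
lemma sum_powerset_rpow_neg_mul_pow_le {s : ℝ} (hs : 1 < s) (S : Finset {p : ℕ // p.Prime}) (K : ℕ) :
    ∑ T ∈ S.powerset, (primeProd T : ℝ) ^ (-s) * (K : ℝ) ^ T.card ≤ (1 + 1 / (s - 1)) ^ K := by
  rw [← prod_one_add_mul_primes]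
  calc ∏ p ∈ S, (1 + (K : ℝ) * ((p : ℕ) : ℝ) ^ (-s))
      ≤ ∏ p ∈ S, (1 + ((p : ℕ) : ℝ) ^ (-s)) ^ K := by
        refine Finset.prod_le_prod (fun _ _ => by positivity) fun p _ => ?_
        refine one_add_mul_le_pow (le_trans (by norm_num) (?_ : (0 : ℝ) ≤ _)) K
        positivity
    _ = (∏ p ∈ S, (1 + ((p : ℕ) : ℝ) ^ (-s))) ^ K := Finset.prod_pow _ _ _
    _ ≤ _ := pow_le_pow_left₀ (Finset.prod_nonneg fun _ _ => by positivity)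
        (prod_one_add_primes_le hs S) K

/-- Rankin's trick for the second moment weights of the tail `n > x`. -/
lemma sum_tail_le {η x : ℝ} (hη : 0 < η) (hx : 1 ≤ x) (S : Finset {p : ℕ // p.Prime}) (K A c : ℕ)
    (hA : x ≤ A) :
    (∑ T ∈ S.powerset, if primeProd T ∈ Finset.Ico A c then
      ((primeProd T : ℝ) ^ (-(1 / 2 + η))) ^ 2 * (K : ℝ) ^ T.card else 0) ≤
      x ^ (-η) * (1 + 1 / η) ^ K := by
  have h := sum_powerset_rpow_neg_mul_pow_le (s := 1 + η) (by linarith) S K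
  rw [add_sub_cancel_left] at h
  refine le_trans ?_ (mul_le_mul_of_nonneg_left h (by positivity))
  rw [Finset.mul_sum]
  refine Finset.sum_le_sum fun T _ => ?_
  split_ifs with hT
  · have hT : x ≤ primeProd T := hA.trans (by exact_mod_cast (Finset.mem_Ico.1 hT).1)
    have hT0 : (0 : ℝ) < primeProd T := by linarith
    rw [← mul_assoc]
    gcongr
    -- Of the exponent 1 + 2η, a part η pays for n ≥ x and 1 + η is kept for convergence.
    rw [← Real.rpow_natCast, ← Real.rpow_mul hT0.le,
      show -(1 / 2 + η) * ((2 : ℕ) : ℝ) = -η + -(1 + η) by push_cast; ring, Real.rpow_add hT0]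
    gcongr ?_ * _
    exact Real.rpow_le_rpow_of_nonpos (by linarith) hT (by linarith)
  · positivity

/-- Reduces to (1 + v)(1 - v + 4v²) = 1 + v²(3 + 4v) ≥ 1. The range covers v = ±p^(-σ), since p^(-σ)
≤ 1/√2 < 3/4. -/
lemma exp_sub_four_mul_sq_le {v : ℝ} (hv : -(3 / 4) ≤ v) :
    Real.exp (v - 4 * v ^ 2) ≤ 1 + v := by
  have h3 := Real.one_sub_le_exp_neg (v - 4 * v ^ 2)
  have hpos : 0 < 1 - (v - 4 * v ^ 2) := by nlinarith [sq_nonneg (v - 1 / 8)]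
  rw [Real.exp_neg, le_inv_comm₀ hpos (Real.exp_pos _)] at h3
  refine h3.trans ?_
  rw [inv_le_iff_one_le_mul₀ hpos]
  nlinarith [mul_nonneg (sq_nonneg v) (by linarith : 0 ≤ 3 + 4 * v)]

/-- The random Euler product is rarely small. -/
lemma IsRademacherFamily.measureReal_euler_le {Ω : Type*} [MeasurableSpace Ω] {P : Measure Ω}
    [IsProbabilityMeasure P] {ε : {p : ℕ // p.Prime} → Ω → ℝ} (h : IsRademacherFamily P ε)
    (S : Finset {p : ℕ // p.Prime}) {σ V r : ℝ} (hσ : 1 / 2 < σ)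
    (hV : ∑ p ∈ S, ((p : ℕ) : ℝ) ^ (-(2 * σ)) ≤ V) (hr : 4 * V ≤ r) :
    P.real {ω | ∏ p ∈ S, (1 + ((p : ℕ) : ℝ) ^ (-σ) * ε p ω) ≤ Real.exp (-r)} ≤
      Real.exp (-(r - 4 * V) ^ 2 / (2 * V)) := by
  have hsq : ∀ p : {p : ℕ // p.Prime}, (((p : ℕ) : ℝ) ^ (-σ)) ^ 2 = ((p : ℕ) : ℝ) ^ (-(2 * σ)) := by
    intro p
    rw [← Real.rpow_natCast, ← Real.rpow_mul (by positivity)]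
    congr 1; push_cast; ring
  have hV' : ∑ p ∈ S, (((p : ℕ) : ℝ) ^ (-σ)) ^ 2 ≤ V := by simpa only [hsq] using hV
  refine le_trans (measureReal_mono fun ω hω => ?_)
    (h.measureReal_sum_le_neg S (fun p => ((p : ℕ) : ℝ) ^ (-σ)) hV' (sub_nonneg.2 hr))
  simp only [Set.mem_ofPred_eq] at hω ⊢
  have hlow : Real.exp (∑ p ∈ S, (((p : ℕ) : ℝ) ^ (-σ) * ε p ω -
      4 * (((p : ℕ) : ℝ) ^ (-σ)) ^ 2)) ≤ Real.exp (-r) := by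
    refine le_trans ?_ hω
    rw [Real.exp_sum]
    refine Finset.prod_le_prod (fun _ _ => (Real.exp_pos _).le) fun p _ => ?_
    have hε : ε p ω ^ 2 = 1 := by rw [← sq_abs, h.abs_eq, one_pow]
    have hu0 : 0 ≤ ((p : ℕ) : ℝ) ^ (-σ) := by positivity
    have hu2 : (((p : ℕ) : ℝ) ^ (-σ)) ^ 2 ≤ 1 / 2 := by
      rw [hsq]
      have hp2 : (2 : ℝ) ≤ (p : ℕ) := by exact_mod_cast p.2.two_le
      calc ((p : ℕ) : ℝ) ^ (-(2 * σ)) ≤ ((p : ℕ) : ℝ) ^ (-1 : ℝ) :=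
            Real.rpow_le_rpow_of_exponent_le (by linarith) (by linarith)
        _ ≤ 1 / 2 := by
            rw [Real.rpow_neg_one, one_div]
            exact inv_anti₀ (by norm_num) hp2
    have := exp_sub_four_mul_sq_le (v := ((p : ℕ) : ℝ) ^ (-σ) * ε p ω) (by
      refine (abs_le.1 (abs_le_of_sq_le_sq ?_ (by norm_num))).1
      rw [mul_pow, hε]; linarith)
    rwa [mul_pow, hε, mul_one] at this
  rw [Real.exp_le_exp, Finset.sum_sub_distrib, ← Finset.mul_sum] at hlow
  linarith

/-! ### Positivity of all long partial sums -/

/-- The values f(p) are ±1 only almost surely; redefining them on a null set gives signs that are ±1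
everywhere. -/
lemma IsRademacherMultiplicative.exists_signs {Ω : Type*} [MeasurableSpace Ω] {P : Measure Ω}
    [IsProbabilityMeasure P] {f : ℕ → Ω → ℝ} (hf : IsRademacherMultiplicative P f) :
    ∃ ε : {p : ℕ // p.Prime} → Ω → ℝ, IsRademacherFamily P ε ∧
      ∀ᵐ ω ∂P, ∀ p : {p : ℕ // p.Prime}, f p ω = ε p ω := by
  classical
  have hg : Measurable fun v : ℝ => if v = 1 then (1 : ℝ) else -1 :=
    Measurable.ite (measurableSet_singleton 1) measurable_const measurable_const
  have hs : ∀ (p : {p : ℕ // p.Prime}) (c : ℝ), MeasurableSet {ω | f p ω = c} := fun p c =>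
    hf.measurable_prime p p.2 (measurableSet_singleton c)
  refine ⟨fun p ω => if f p ω = 1 then 1 else -1, ⟨fun p => hg.comp (hf.measurable_prime p p.2),
    fun p ω => ?_, fun p => ?_, hf.indep.comp (fun _ v => if v = 1 then 1 else -1) fun _ => hg⟩, ?_⟩
  · split_ifs <;> simp
  · have e : ∀ ω, (if f p ω = 1 then (1 : ℝ) else -1) =
        2 * {ω | f p ω = 1}.indicator (fun _ => (1 : ℝ)) ω - 1 := fun ω => by
      simp only [Set.indicator_apply, Set.mem_ofPred_eq]
      split_ifs <;> norm_num
    simp_rw [e]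
    rw [integral_sub (((integrable_const (1 : ℝ)).indicator (hs p 1)).const_mul 2)
      (integrable_const _), integral_const_mul, integral_indicator_const _ (hs p 1),
      measureReal_def, hf.prob_one p p.2]
    simp
  · rw [ae_all_iff]
    intro p
    have hdisj : Disjoint {ω | f p ω = 1} {ω | f p ω = -1} := by
      rw [Set.disjoint_left]
      intro ω h1 h2
      simp only [Set.mem_ofPred_eq] at h1 h2
      rw [h1] at h2; norm_num at h2
    have hU : P ({ω | f p ω = 1} ∪ {ω | f p ω = -1}) = 1 := by
      rw [measure_union hdisj (hs p (-1)), hf.prob_one p p.2, hf.prob_neg_one p p.2,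
        ENNReal.add_halves]
    have hae := (prob_compl_eq_zero_iff ((hs p 1).union (hs p (-1)))).2 hU
    filter_upwards [compl_mem_ae_iff.2 hae] with ω hω
    rw [compl_compl] at hω
    rcases hω with h | h
    · simp only [Set.mem_ofPred_eq] at h
      simp [h]
    · simp only [Set.mem_ofPred_eq] at h
      rw [h]; norm_num

lemma measureReal_le_div_of_integral_le {Ω : Type*} [MeasurableSpace Ω] {P : Measure Ω}
    [IsFiniteMeasure P] {Φ : Ω → ℝ} (hi : Integrable Φ P) (h0 : ∀ ω, 0 ≤ Φ ω) {c B : ℝ}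
    (hc : 0 < c) (hB : ∫ ω, Φ ω ∂P ≤ B) : P.real {ω | c ≤ Φ ω} ≤ B / c := by
  rw [le_div_iff₀ hc, mul_comm]
  exact (mul_meas_ge_le_integral_of_nonneg (Filter.Eventually.of_forall h0) hi c).trans hB

/-- The probability that some partial sum of length between `x` and `N` is negative. -/
lemma IsRademacherMultiplicative.measureReal_exists_neg_le {Ω : Type*} [MeasurableSpace Ω]
    {P : Measure Ω} [IsProbabilityMeasure P] {f : ℕ → Ω → ℝ}
    (hf : IsRademacherMultiplicative P f) {η x V r : ℝ} (hη : 0 < η) (hx : 1 ≤ x) {k : ℕ}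
    (hk : 5 ≤ k) (hV : 2 * Real.log (1 + 1 / (2 * η)) ≤ V) (hr : 4 * V ≤ r) (N : ℕ) :
    P.real {ω | ∃ y : ℝ, x < y ∧ ⌊y⌋₊ ≤ N ∧ weightedPartialSum f (1 / 2 + η) y ω < 0} ≤
      Real.exp (-(r - 4 * V) ^ 2 / (2 * V)) +
        25 ^ k * (x ^ (-η) * (1 + 1 / η) ^ (2 * k - 1)) ^ k / (Real.exp (-r) / 2) ^ (2 * k) := by
  obtain ⟨ε, hε, hae⟩ := hf.exists_signs
  set S := primesUpTo N
  -- M exceeds every product of primes in S and is at least ⌊y⌋ + 1, so both endpoints used below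
  -- are covered by the maximal bound.
  set M := primeProd S + N + 1
  set A := ⌊x⌋₊ + 1 with hA
  have hxA : x ≤ (A : ℕ) := by
    rw [hA]; push_cast; exact (Nat.lt_floor_add_one x).le
  obtain ⟨Φ, hΦi, hΦ0, hΦ, hΦm⟩ := hε.exists_chaos_maximal_bound hk
    (K := ((2 * k - 1 : ℕ) : ℝ)) (by rw [Nat.cast_sub (by omega)]; push_cast; rfl) S
    (fun T => (primeProd T : ℝ) ^ (-(1 / 2 + η))) primeProd A M
  have hΦm' := hΦm.trans (mul_le_mul_of_nonneg_left (pow_le_pow_left₀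
    (Finset.sum_nonneg fun T _ => by split_ifs <;> positivity)
    (sum_tail_le hη hx S (2 * k - 1) A M hxA) k) (by positivity))
  have hτ : 0 < Real.exp (-r) / 2 := by positivity
  have hP1 := hε.measureReal_euler_le S (σ := 1 / 2 + η) (by linarith)
    ((sum_primes_rpow_neg_le (by linarith) S).trans (by
      rwa [show 2 * (1 / 2 + η) - 1 = 2 * η by ring])) hr
  have hP2 := measureReal_le_div_of_integral_le hΦi hΦ0 (pow_pos hτ (2 * k)) hΦm'
  refine le_trans ?_ (add_le_add hP1 hP2)
  refine le_trans ?_ (measureReal_union_le _ _)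
  refine ENNReal.toReal_mono (measure_ne_top _ _) (measure_mono_ae ?_)
  filter_upwards [hae] with ω hω
  rintro ⟨y, hxy, hyN, hneg⟩
  by_contra hcon
  have h1 : Real.exp (-r) < ∏ p ∈ S, (1 + ((p : ℕ) : ℝ) ^ (-(1 / 2 + η)) * ε p ω) :=
    not_le.1 fun h => hcon (Or.inl h)
  have h2 : Φ ω < (Real.exp (-r) / 2) ^ (2 * k) := not_le.1 fun h => hcon (Or.inr h)
  rw [← chaos_primeProd_eq_prod] at h1
  rw [weightedPartialSum_eq_chaos (fun n hn => hf.apply_eq n hn ω) hω hyN] at hneg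
  have hAy : A ≤ ⌊y⌋₊ + 1 := Nat.add_le_add_right (Nat.floor_le_floor hxy.le) 1
  have hsmall : ∀ j ≤ M, |chaos ε S (fun T => if primeProd T ∈ Finset.Ico A j then
      (primeProd T : ℝ) ^ (-(1 / 2 + η)) else 0) ω| < Real.exp (-r) / 2 := by
    intro j hj
    have := (hΦ ω j hj).trans_lt h2
    rw [← (even_two_mul k).pow_abs] at this
    exact lt_of_pow_lt_pow_left₀ _ hτ.le this
  -- The tail beyond y is a difference of two blocks starting at A. Each is below e^(-r)/2 in
  -- absolute value, while the full product exceeds e^(-r).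
  have hsplit : chaos ε S (fun T => (primeProd T : ℝ) ^ (-(1 / 2 + η))) ω =
      chaos ε S (fun T => if primeProd T ≤ ⌊y⌋₊ then
        (primeProd T : ℝ) ^ (-(1 / 2 + η)) else 0) ω +
      (chaos ε S (fun T => if primeProd T ∈ Finset.Ico A M then
        (primeProd T : ℝ) ^ (-(1 / 2 + η)) else 0) ω -
      chaos ε S (fun T => if primeProd T ∈ Finset.Ico A (⌊y⌋₊ + 1) then
        (primeProd T : ℝ) ^ (-(1 / 2 + η)) else 0) ω) := by
    unfold chaos
    rw [← Finset.sum_sub_distrib, ← Finset.sum_add_distrib]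
    refine Finset.sum_congr rfl fun T hT => ?_
    have hTM : primeProd T < M := by
      have := primeProd_le (Finset.mem_powerset.1 hT)
      omega
    rw [← sub_mul, ← add_mul]
    congr 1
    simp only [Finset.mem_Ico]
    split_ifs <;> first | omega | simp
  have hb1 := abs_lt.1 (hsmall M le_rfl)
  have hb2 := abs_lt.1 (hsmall (⌊y⌋₊ + 1) (by omega))
  linarith

lemma IsRademacherMultiplicative.measure_exists_neg_le {Ω : Type*} [MeasurableSpace Ω]
    {P : Measure Ω} [IsProbabilityMeasure P] {f : ℕ → Ω → ℝ} {σ x B : ℝ}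
    (h : ∀ N : ℕ, P.real {ω | ∃ y : ℝ, x < y ∧ ⌊y⌋₊ ≤ N ∧ weightedPartialSum f σ y ω < 0} ≤ B) :
    P {ω | ∃ y : ℝ, x < y ∧ weightedPartialSum f σ y ω < 0} ≤ ENNReal.ofReal B := by
  have hU : {ω | ∃ y : ℝ, x < y ∧ weightedPartialSum f σ y ω < 0} =
      ⋃ N : ℕ, {ω | ∃ y : ℝ, x < y ∧ ⌊y⌋₊ ≤ N ∧ weightedPartialSum f σ y ω < 0} := by
    ext ω
    simp only [Set.mem_ofPred_eq, Set.mem_iUnion]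
    exact ⟨fun ⟨y, h1, h2⟩ => ⟨⌊y⌋₊, y, h1, le_rfl, h2⟩, fun ⟨_, y, h1, _, h2⟩ => ⟨y, h1, h2⟩⟩
  have hmono : Monotone fun N : ℕ =>
      {ω | ∃ y : ℝ, x < y ∧ ⌊y⌋₊ ≤ N ∧ weightedPartialSum f σ y ω < 0} :=
    fun N M hNM ω ⟨y, h1, h2, h3⟩ => ⟨y, h1, h2.trans hNM, h3⟩
  rw [hU, hmono.measure_iUnion]
  refine iSup_le fun N => ?_
  rw [← ofReal_measureReal]
  exact ENNReal.ofReal_le_ofReal (h N)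

/-- The bound for all `y > x` in terms of `L = log x`, `D = η L` and `ℓ = log L`. -/
lemma IsRademacherMultiplicative.measure_exists_neg_le_exp {Ω : Type*} [MeasurableSpace Ω]
    {P : Measure Ω} [IsProbabilityMeasure P] {f : ℕ → Ω → ℝ}
    (hf : IsRademacherMultiplicative P f) {η x ℓ D : ℝ} (hη : 0 < η) (hx : 1 ≤ x)
    (hℓ : 1 ≤ ℓ) (hD : η * Real.log x = D) (hηℓ : 1 + 1 / η ≤ Real.exp ℓ)
    (hDℓ : 128 * ℓ ≤ D) :
    P {ω | ∃ y : ℝ, x < y ∧ weightedPartialSum f (1 / 2 + η) y ω < 0} ≤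
      ENNReal.ofReal (2 * Real.exp (-(D ^ 2 / (1024 * ℓ)))) := by
  have hℓ0 : 0 < ℓ := by linarith
  have hD0 : 0 < D := by linarith
  -- The largest k with 2kℓ ≤ D/2, so that the factor (1 + 1/η)^(2k - 1) uses up at most half of the
  -- Rankin saving e^(-D).
  set k := ⌊D / (4 * ℓ)⌋₊
  have hk1 : (k : ℝ) ≤ D / (4 * ℓ) := Nat.floor_le (by positivity)
  have hk2 : D / (4 * ℓ) < k + 1 := Nat.lt_floor_add_one _
  have hD32 : 32 ≤ D / (4 * ℓ) := by rw [le_div_iff₀ (by positivity)]; linarith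
  have hk5 : 5 ≤ k := Nat.le_floor (by push_cast; linarith)
  have hk3 : D / (8 * ℓ) ≤ k := by
    have : D / (8 * ℓ) = D / (4 * ℓ) / 2 := by field_simp; norm_num
    linarith
  have hkD : k * (4 * ℓ) ≤ D := (le_div_iff₀ (by positivity)).1 hk1
  refine measure_exists_neg_le fun N => ?_
  have hlog : 2 * Real.log (1 + 1 / (2 * η)) ≤ 2 * ℓ := by
    have : 1 + 1 / (2 * η) ≤ Real.exp ℓ := by
      refine le_trans ?_ hηℓ
      gcongr
      linarith
    have := (Real.log_le_iff_le_exp (by positivity)).2 this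
    linarith
  -- With V = 2ℓ and D ≥ 128ℓ, r - 4V is at least D/16, which produces the constant 1024.
  refine (hf.measureReal_exists_neg_le hη hx hk5 hlog (r := D / 8) (by linarith) N).trans ?_
  rw [two_mul (Real.exp _)]
  refine add_le_add (Real.exp_le_exp.2 ?_) ?_
  · rw [neg_div]
    refine neg_le_neg ?_
    calc D ^ 2 / (1024 * ℓ) = (D / 16) ^ 2 / (2 * (2 * ℓ)) := by field_simp; norm_num
      _ ≤ (D / 8 - 4 * (2 * ℓ)) ^ 2 / (2 * (2 * ℓ)) := by
        gcongr
        linarith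
  · have hxη : x ^ (-η) = Real.exp (-D) := by
      rw [Real.rpow_def_of_pos (by linarith), ← hD]; congr 1; ring
    have hG : x ^ (-η) * (1 + 1 / η) ^ (2 * k - 1) ≤ Real.exp (-(D / 2)) := by
      calc x ^ (-η) * (1 + 1 / η) ^ (2 * k - 1)
          ≤ Real.exp (-D) * Real.exp ℓ ^ (2 * k) := by
            rw [hxη]
            gcongr ?_ * ?_
            calc (1 + 1 / η) ^ (2 * k - 1) ≤ (1 + 1 / η) ^ (2 * k) :=
                  pow_le_pow_right₀ (by simp; positivity) (by omega)
              _ ≤ _ := by gcongr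
        _ = Real.exp (-D + (2 * k : ℕ) * ℓ) := by rw [← Real.exp_nat_mul, Real.exp_add]
        _ ≤ _ := by
            refine Real.exp_le_exp.2 ?_
            push_cast; linarith
    have h100 : (100 : ℝ) ≤ Real.exp (D / 8) := by
      have h1 : (2 : ℝ) ≤ Real.exp 1 := by linarith [Real.add_one_le_exp 1]
      calc (100 : ℝ) ≤ 2 ^ 16 := by norm_num
        _ ≤ Real.exp 1 ^ 16 := by gcongr
        _ = Real.exp 16 := by rw [← Real.exp_nat_mul]; norm_num
        _ ≤ _ := Real.exp_le_exp.2 (by linarith)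
    calc 25 ^ k * (x ^ (-η) * (1 + 1 / η) ^ (2 * k - 1)) ^ k /
          (Real.exp (-(D / 8)) / 2) ^ (2 * k)
        ≤ 25 ^ k * Real.exp (-(D / 2)) ^ k / (Real.exp (-(D / 8)) / 2) ^ (2 * k) := by gcongr
      _ = (25 * Real.exp (-(D / 2)) / (Real.exp (-(D / 8)) / 2) ^ 2) ^ k := by
          rw [pow_mul (Real.exp (-(D / 8)) / 2), ← mul_pow, ← div_pow]
      _ = (100 * Real.exp (-(D / 4))) ^ k := by
          congr 1
          rw [div_pow, ← Real.exp_nat_mul, div_div_eq_mul_div, div_eq_iff (Real.exp_pos _).ne',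
            mul_assoc 100, ← Real.exp_add]
          rw [show -(D / 4) + ((2 : ℕ) : ℝ) * -(D / 8) = -(D / 2) by push_cast; ring]
          ring
      _ ≤ (Real.exp (D / 8) * Real.exp (-(D / 4))) ^ k := by gcongr
      _ = Real.exp (-(k * (D / 8))) := by
          rw [← Real.exp_add, ← Real.exp_nat_mul]; congr 1; ring
      _ ≤ Real.exp (-(D ^ 2 / (1024 * ℓ))) := by
          refine Real.exp_le_exp.2 (neg_le_neg ?_)
          calc D ^ 2 / (1024 * ℓ) ≤ D ^ 2 / (64 * ℓ) := by gcongr; norm_num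
            _ = D / (8 * ℓ) * (D / 8) := by field_simp; norm_num
            _ ≤ _ := by gcongr

/-- The parameter inequalities, for `L = log x` large. -/
lemma eventually_parameters {δ θ : ℝ} (hδ : 0 < δ) (hθ : θ ∈ Set.Ioo (0 : ℝ) 1) :
    ∀ᶠ L : ℝ in Filter.atTop, 1 ≤ Real.log L ∧ 1 + L ^ θ ≤ L ∧
      128 * Real.log L ≤ L ^ (1 - θ) ∧ 2048 ≤ (L ^ (1 - θ)) ^ 2 / Real.log L ∧
      1024 / θ ≤ Real.log L ^ (2 * δ) := by
  have h1 : ∀ᶠ L : ℝ in Filter.atTop, 1 ≤ Real.log L :=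
    Real.tendsto_log_atTop.eventually_ge_atTop 1
  have h2 : ∀ᶠ L : ℝ in Filter.atTop, 2 ≤ L ^ (1 - θ) :=
    (tendsto_rpow_atTop (by linarith [hθ.2])).eventually_ge_atTop 2
  have h3 : ∀ᶠ L : ℝ in Filter.atTop, 1024 / θ ≤ Real.log L ^ (2 * δ) :=
    ((tendsto_rpow_atTop (by linarith)).comp Real.tendsto_log_atTop).eventually_ge_atTop _
  -- The single bound log L ≤ L^(1 - θ) / 2048 yields both numerical conditions linking log L and
  -- L^(1 - θ).
  have h4 := (isLittleO_log_rpow_atTop (show 0 < 1 - θ by linarith [hθ.2])).bound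
    (show (0 : ℝ) < 1 / 2048 by norm_num)
  filter_upwards [h1, h2, h3, h4, Filter.eventually_ge_atTop 1] with L h1 h2 h3 h4 h5
  have hL0 : 0 < L := by linarith
  have hp : 0 < L ^ (1 - θ) := by positivity
  rw [Real.norm_of_nonneg (by linarith), Real.norm_of_nonneg hp.le] at h4
  refine ⟨h1, ?_, by linarith, ?_, h3⟩
  · have hLL : L ^ θ * L ^ (1 - θ) = L := by
      rw [← Real.rpow_add hL0, add_sub_cancel, Real.rpow_one]
    have h6 : 1 ≤ L ^ θ := Real.one_le_rpow h5 hθ.1.le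
    nlinarith
  · rw [le_div_iff₀ (by linarith)]
    nlinarith

/-- The factor ℓ^(2δ) brings the target exponent down to half of D²/(1024ℓ); the other half is at
least 1 and absorbs the factor 2 ≤ e. -/
lemma two_mul_exp_le {δ θ D ℓ : ℝ} (hθ : 0 < θ) (hℓ : 1 ≤ ℓ)
    (h1 : 2048 ≤ D ^ 2 / ℓ) (h2 : 1024 / θ ≤ ℓ ^ (2 * δ)) :
    2 * Real.exp (-(D ^ 2 / (1024 * ℓ))) ≤
      Real.exp (-(1 / (2 * θ) * (D ^ 2 / ℓ ^ (1 + 2 * δ)))) := by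
  have hℓ0 : 0 < ℓ := by linarith
  have h3 : (2 : ℝ) ≤ Real.exp 1 := by linarith [Real.add_one_le_exp 1]
  have h4 : 1 / (2 * θ) * (D ^ 2 / ℓ ^ (1 + 2 * δ)) ≤ D ^ 2 / ℓ / 2048 := by
    rw [Real.rpow_add hℓ0, Real.rpow_one]
    calc 1 / (2 * θ) * (D ^ 2 / (ℓ * ℓ ^ (2 * δ)))
        = D ^ 2 / ℓ * (1 / (2 * θ)) / ℓ ^ (2 * δ) := by field_simp
      _ ≤ D ^ 2 / ℓ * (1 / (2 * θ)) / (1024 / θ) := by gcongr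
      _ = D ^ 2 / ℓ / 2048 := by field_simp; ring
  have h5 : D ^ 2 / (1024 * ℓ) = D ^ 2 / ℓ / 1024 := by field_simp
  calc 2 * Real.exp (-(D ^ 2 / (1024 * ℓ)))
      ≤ Real.exp 1 * Real.exp (-(D ^ 2 / (1024 * ℓ))) := by gcongr
    _ = Real.exp (1 + -(D ^ 2 / (1024 * ℓ))) := (Real.exp_add _ _).symm
    _ ≤ _ := Real.exp_le_exp.2 (by rw [h5]; linarith)

theorem mainTheorem2 (δ θ : ℝ) (hδ : 0 < δ) (hθ : θ ∈ Set.Ioo (0 : ℝ) 1) :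
    ∃ σ₀ ∈ Set.Ioc (1 / 2 : ℝ) 1,
      ∀ (Ω : Type*) [MeasurableSpace Ω] (P : Measure Ω) [IsProbabilityMeasure P]
        (f : ℕ → Ω → ℝ), IsRademacherMultiplicative P f →
      ∀ σ : ℝ, 1 / 2 < σ → σ ≤ σ₀ →
      ∀ x : ℝ, 1 ≤ x → Real.log x = 1 / (σ - 1 / 2) ^ (1 / θ) →
        P {ω | ∃ y : ℝ, x < y ∧ weightedPartialSum f σ y ω < 0} ≤
          ENNReal.ofReal (Real.exp (-(1 / (2 * θ) *
            (Real.log x ^ (2 - 2 * θ) / Real.log (Real.log x) ^ (1 + 2 * δ))))) := by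
  have hθ0 : 0 < θ := hθ.1
  obtain ⟨L₀, hL₀⟩ := Filter.eventually_atTop.1 (eventually_parameters hδ hθ)
  set L₁ := max L₀ 1
  have hL₁0 : 0 < L₁ := by positivity
  -- Since η = L^(-θ), the condition η ≤ L₁^(-θ) says exactly that L ≥ L₁; the other term keeps σ₀ ≤
  -- 1.
  refine ⟨1 / 2 + min (1 / 2) (L₁ ^ (-θ)), ⟨?_, ?_⟩, ?_⟩
  · have : 0 < min (1 / 2) (L₁ ^ (-θ)) := lt_min (by norm_num) (by positivity)
    linarith
  · linarith [min_le_left (1 / 2) (L₁ ^ (-θ))]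
  intro Ω _ P _ f hf σ hσ hσ₀ x hx hlog
  obtain ⟨η, rfl⟩ : ∃ η, σ = 1 / 2 + η := ⟨σ - 1 / 2, by ring⟩
  have hη : 0 < η := by linarith
  have hηL : η ≤ L₁ ^ (-θ) := by linarith [min_le_right (1 / 2) (L₁ ^ (-θ))]
  rw [add_sub_cancel_left, one_div, ← Real.rpow_neg hη.le] at hlog
  set L := Real.log x
  have hL0 : 0 < L := by rw [hlog]; positivity
  have hηeq : η = L ^ (-θ) := by
    rw [hlog, ← Real.rpow_mul hη.le]
    rw [show -(1 / θ) * -θ = 1 by field_simp, Real.rpow_one]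
  have hLL₀ : L₀ ≤ L := by
    refine (le_max_left L₀ 1).trans ?_
    rw [hηeq] at hηL
    exact (Real.rpow_le_rpow_iff_of_neg hL0 hL₁0 (by linarith)).1 hηL
  obtain ⟨h1, h2, h3, h4, h5⟩ := hL₀ L hLL₀
  have hD : η * L = L ^ (1 - θ) := by
    rw [hηeq]
    nth_rewrite 2 [← Real.rpow_one L]
    rw [← Real.rpow_add hL0]; congr 1; ring
  have hDsq : L ^ (2 - 2 * θ) = (L ^ (1 - θ)) ^ 2 := by
    rw [← Real.rpow_natCast, ← Real.rpow_mul hL0.le]; congr 1; push_cast; ring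
  have hinv : 1 + 1 / η ≤ Real.exp (Real.log L) := by
    rw [Real.exp_log hL0, hηeq, Real.rpow_neg hL0.le, one_div, inv_inv]
    exact h2
  refine (hf.measure_exists_neg_le_exp hη hx h1 hD hinv h3).trans
    (ENNReal.ofReal_le_ofReal ?_)
  rw [hDsq]
  exact two_mul_exp_le hθ0 h1 h4 h5
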